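/- Let $K$ be an algebraically closed field of characteristic $0$ (for example $K=\mathbb{C}$), let $R=K[x,y,z]$, let $\mathfrak m=(x,y,z)$, and let $$I_2=\bigl(x(y^2-z^2),\;y(z^2-x^2),\;z(x^2-y^2)\bigr)\subset R.$$ For an integer $m\ge 0$ let $I_2^{(m)}=\bigcap_{\mathfrak p\in\operatorname{Ass}(R/I_2)}\bigl(I_2^mR_{\mathfrak p}\cap R\bigr)$ denote the $m$-th symbolic power of $I_2$. Then: 1. $I_2^{(2r-2)}\subseteq \mathfrak m^{r}I_2^{r}$ for all $r\ge 5$; 2. $I_2^{(2r)}\subseteq \mathfrak m^{r}I_2^{r}$ for all $r\ge 0$; 3. $I_2^{(2r-1)}\subseteq \mathfrak m^{r-1}I_2^{r}$ for all $r\ge 1$. -/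

import Mathlib

/-- The `m`-th symbolic power of an ideal `I` of a commutative ring `R`:
the intersection, over the associated primes `p` of `R ⧸ I`, of the
contractions to `R` of the extended ideals `I ^ m R_p`. -/
noncomputable def Ideal.symbolicPower {R : Type*} [CommRing R] (I : Ideal R) (m : ℕ) : Ideal R :=
  ⨅ p : associatedPrimes R (R ⧸ I),
    ((I ^ m).map (algebraMap R (Localization.AtPrime p.1))).comap
      (algebraMap R (Localization.AtPrime p.1))

/-- The Fermat ideal `I_n = (x (y^n - z^n), y (z^n - x^n), z (x^n - y^n))` of `K[x, y, z]`,
with `x = X 0`, `y = X 1`, `z = X 2`. -/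
noncomputable def fermatIdeal (K : Type*) [Field K] (n : ℕ) : Ideal (MvPolynomial (Fin 3) K) :=
  Ideal.span
    {MvPolynomial.X 0 * (MvPolynomial.X 1 ^ n - MvPolynomial.X 2 ^ n),
     MvPolynomial.X 1 * (MvPolynomial.X 2 ^ n - MvPolynomial.X 0 ^ n),
     MvPolynomial.X 2 * (MvPolynomial.X 0 ^ n - MvPolynomial.X 1 ^ n)}

/-! The ideal `fermatIdeal K 2` defines seven points: the three coordinate points and the four
points (±1 : ±1 : 1). An element of the `m`-th symbolic power has order at least `m` at each of
them. Scalings by 2 and by signs preserve the conditions at the four sign points, while the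
conditions at the coordinate points concern only exponents. So the element may be assumed
homogeneous with fixed parity in each variable, that is, a monomial times q(x², y², z²).

In u = x², v = y², w = z² the four sign points become (1,1,1), so q satisfies conditions at four
general points. By `mem_span_diffProducts` q is a combination of products of the six lines joining
these points. Hence the original element is a combination of products of x, y, z, x²-y², y²-z²,
z²-x² with order at least `m` at all seven points. `lineProduct_mem_pow` puts each such product into
I^r, combinatorially, from a few explicit memberships.

Such a product has degree at least 5m/2, and I^r is generated in degree 3r, so the surplus degree
supplies the power of the maximal ideal (`mem_pow_idealOfVars_mul_span_pow`). The three claims are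
numerical instances of `symbolicPower_fermatIdeal_two_le`. -/

/-! ### Products of lines in powers of I. -/

section Products

variable {R : Type*} [CommRing R]

/-- The product `x^A y^B z^C (x²-y²)^d (y²-z²)^e (z²-x²)^f`. -/
def lineProduct (x y z : R) (A B C d e f : ℕ) : R :=
  x ^ A * y ^ B * z ^ C * (x ^ 2 - y ^ 2) ^ d * (y ^ 2 - z ^ 2) ^ e * (z ^ 2 - x ^ 2) ^ f

theorem lineProduct_rotate (x y z : R) (A B C d e f : ℕ) :
    lineProduct x y z A B C d e f = lineProduct y z x B C A e f d := by
  unfold lineProduct; ring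

theorem lineProduct_add (x y z : R) (A B C d e f A' B' C' d' e' f' : ℕ) :
    lineProduct x y z (A + A') (B + B') (C + C') (d + d') (e + e') (f + f') =
      lineProduct x y z A B C d e f * lineProduct x y z A' B' C' d' e' f' := by
  unfold lineProduct; ring

theorem Ideal.mul_mem_pow_add {I : Ideal R} {a b : R} {m n : ℕ} (ha : a ∈ I ^ m) (hb : b ∈ I ^ n) :
    a * b ∈ I ^ (m + n) := by
  rw [pow_add]; exact Ideal.mul_mem_mul ha hb

theorem Ideal.mul_mul_mem_pow_three {I : Ideal R} {a b c : R} (s : R) (ha : a ∈ I) (hb : b ∈ I)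
    (hc : c ∈ I) : s * (a * b * c) ∈ I ^ 3 := by
  apply Ideal.mul_mem_left
  rw [pow_succ, pow_two]
  exact Ideal.mul_mem_mul (Ideal.mul_mem_mul ha hb) hc

variable {I : Ideal R} {x y z : R}

/-- Each variable is paired with the difference of the other two squares to form a generator; here
powers of the three generators are split off. -/
theorem lineProduct_mem_of_le (hf : x * (y ^ 2 - z ^ 2) ∈ I) (hg : y * (z ^ 2 - x ^ 2) ∈ I)
    (hh : z * (x ^ 2 - y ^ 2) ∈ I) {A B C d e f i j k : ℕ} (h1 : i ≤ A) (h2 : i ≤ e) (h3 : j ≤ B)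
    (h4 : j ≤ f) (h5 : k ≤ C) (h6 : k ≤ d) {s : ℕ}
    (h : lineProduct x y z (A - i) (B - j) (C - k) (d - k) (e - i) (f - j) ∈ I ^ s) :
    lineProduct x y z A B C d e f ∈ I ^ (i + j + k + s) := by
  have e1 : lineProduct x y z A B C d e f =
      ((x * (y ^ 2 - z ^ 2)) ^ i * (y * (z ^ 2 - x ^ 2)) ^ j * (z * (x ^ 2 - y ^ 2)) ^ k) *
        lineProduct x y z (A - i) (B - j) (C - k) (d - k) (e - i) (f - j) := by
    have := lineProduct_add x y z i j k k i j (A - i) (B - j) (C - k) (d - k) (e - i) (f - j)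
    rw [Nat.add_sub_cancel' h1, Nat.add_sub_cancel' h2, Nat.add_sub_cancel' h3,
      Nat.add_sub_cancel' h4, Nat.add_sub_cancel' h5, Nat.add_sub_cancel' h6] at this
    rw [this]; congr 1; unfold lineProduct; simp only [mul_pow]; ring
  rw [e1]
  exact Ideal.mul_mem_pow_add (Ideal.mul_mem_pow_add (Ideal.mul_mem_pow_add
    (Ideal.pow_mem_pow hf _) (Ideal.pow_mem_pow hg _)) (Ideal.pow_mem_pow hh _)) h

/-- The product of the six lines lies in `I`. -/
theorem sixLines_mem (hf : x * (y ^ 2 - z ^ 2) ∈ I) (hg : y * (z ^ 2 - x ^ 2) ∈ I) :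
    lineProduct x y z 0 0 0 1 1 1 ∈ I := by
  have : lineProduct x y z 0 0 0 1 1 1 = (x * (z ^ 2 - x ^ 2)) * (x * (y ^ 2 - z ^ 2)) -
      (y * (y ^ 2 - z ^ 2)) * (y * (z ^ 2 - x ^ 2)) := by unfold lineProduct; ring
  rw [this]
  exact sub_mem (Ideal.mul_mem_left _ _ hf) (Ideal.mul_mem_left _ _ hg)

/-- The sum of the generators is, up to sign, the Vandermonde product (x-y)(y-z)(z-x). Sign changes
of the variables give four such cubics, in which each of the six lines occurs twice. -/
theorem sixLines_sq_mem (hf : x * (y ^ 2 - z ^ 2) ∈ I) (hg : y * (z ^ 2 - x ^ 2) ∈ I)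
    (hh : z * (x ^ 2 - y ^ 2) ∈ I) : lineProduct x y z 0 0 0 2 2 2 ∈ I ^ 4 := by
  set f := x * (y ^ 2 - z ^ 2) with hf'
  set g := y * (z ^ 2 - x ^ 2) with hg'
  set h := z * (x ^ 2 - y ^ 2) with hh'
  have : lineProduct x y z 0 0 0 2 2 2 =
      (f + g + h) * (f - g - h) * ((f - g + h) * (f + g - h)) := by
    rw [hf', hg', hh']; unfold lineProduct; ring
  rw [this, show (4 : ℕ) = 1 + 1 + (1 + 1) from rfl]
  refine Ideal.mul_mem_pow_add (Ideal.mul_mem_pow_add ?_ ?_) (Ideal.mul_mem_pow_add ?_ ?_) <;>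
    rw [pow_one]
  · exact add_mem (add_mem hf hg) hh
  · exact sub_mem (sub_mem hf hg) hh
  · exact add_mem (sub_mem hf hg) hh
  · exact sub_mem (add_mem hf hg) hh

theorem sixLines_pow_mem (hf : x * (y ^ 2 - z ^ 2) ∈ I) (hg : y * (z ^ 2 - x ^ 2) ∈ I)
    (hh : z * (x ^ 2 - y ^ 2) ∈ I) (n : ℕ) : lineProduct x y z 0 0 0 n n n ∈ I ^ (2 * n - 1) := by
  have key (q : ℕ) : lineProduct x y z 0 0 0 (2 * q) (2 * q) (2 * q) ∈ I ^ (4 * q) := by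
    have : lineProduct x y z 0 0 0 (2 * q) (2 * q) (2 * q) =
        lineProduct x y z 0 0 0 2 2 2 ^ q := by
      simp only [lineProduct, mul_pow, ← pow_mul, zero_mul]
    rw [this, pow_mul]
    exact Ideal.pow_mem_pow (sixLines_sq_mem hf hg hh) q
  obtain ⟨q, rfl | rfl⟩ := Nat.even_or_odd' n
  · exact Ideal.pow_le_pow_right (by omega) (key q)
  · have := lineProduct_add x y z 0 0 0 (2 * q) (2 * q) (2 * q) 0 0 0 1 1 1
    simp only [Nat.add_zero] at this
    rw [this, show 2 * (2 * q + 1) - 1 = 4 * q + 1 by omega]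
    exact Ideal.mul_mem_pow_add (key q) (by rw [pow_one]; exact sixLines_mem hf hg)

theorem lineProduct_mono {A B C d e f A' B' C' d' e' f' s : ℕ}
    (h : lineProduct x y z A' B' C' d' e' f' ∈ I ^ s) (h1 : A' ≤ A) (h2 : B' ≤ B) (h3 : C' ≤ C)
    (h4 : d' ≤ d) (h5 : e' ≤ e) (h6 : f' ≤ f) :
    lineProduct x y z A B C d e f ∈ I ^ s := by
  have := lineProduct_add x y z A' B' C' d' e' f' (A - A') (B - B') (C - C') (d - d') (e - e')
    (f - f')
  rw [Nat.add_sub_cancel' h1, Nat.add_sub_cancel' h2, Nat.add_sub_cancel' h3,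
      Nat.add_sub_cancel' h4, Nat.add_sub_cancel' h5, Nat.add_sub_cancel' h6] at this
  rw [this]
  exact Ideal.mul_mem_right _ _ h

theorem lineProduct_mem_of_le_pow (hf : x * (y ^ 2 - z ^ 2) ∈ I) (hg : y * (z ^ 2 - x ^ 2) ∈ I)
    (hh : z * (x ^ 2 - y ^ 2) ∈ I) {A B C d e f i j k n r : ℕ} (h1 : i ≤ A) (h2 : i + n ≤ e)
    (h3 : j ≤ B) (h4 : j + n ≤ f) (h5 : k ≤ C) (h6 : k + n ≤ d) (hr : r ≤ i + j + k + (2 * n - 1)) :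
    lineProduct x y z A B C d e f ∈ I ^ r := by
  refine Ideal.pow_le_pow_right hr (lineProduct_mem_of_le hf hg hh h1 (by omega) h3 (by omega) h5
    (by omega) (lineProduct_mono (sixLines_pow_mem hf hg hh n) ?_ ?_ ?_ ?_ ?_ ?_)) <;> omega

/-- This and the next two elements settle the borderline m = 2r-2. Splitting off generators only
shows that they lie in I²; the third factor comes from a combination of cubic monomials in the
generators with linear coefficients. -/
theorem cubic_mem_one (hf : x * (y ^ 2 - z ^ 2) ∈ I) (hg : y * (z ^ 2 - x ^ 2) ∈ I)
    (hh : z * (x ^ 2 - y ^ 2) ∈ I) : lineProduct x y z 2 0 0 1 2 1 ∈ I ^ 3 := by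
  have : lineProduct x y z 2 0 0 1 2 1 =
      -y * (x * (y ^ 2 - z ^ 2) * (x * (y ^ 2 - z ^ 2)) * (y * (z ^ 2 - x ^ 2))) +
      -x * (x * (y ^ 2 - z ^ 2) * (y * (z ^ 2 - x ^ 2)) * (y * (z ^ 2 - x ^ 2))) +
      x * (x * (y ^ 2 - z ^ 2) * (z * (x ^ 2 - y ^ 2)) * (z * (x ^ 2 - y ^ 2))) +
      z * (x * (y ^ 2 - z ^ 2) * (x * (y ^ 2 - z ^ 2)) * (z * (x ^ 2 - y ^ 2))) := by
    unfold lineProduct; ring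
  rw [this]
  apply_rules [add_mem, Ideal.mul_mul_mem_pow_three]

theorem cubic_mem_two (hf : x * (y ^ 2 - z ^ 2) ∈ I) (hg : y * (z ^ 2 - x ^ 2) ∈ I)
    (hh : z * (x ^ 2 - y ^ 2) ∈ I) : lineProduct x y z 4 0 0 1 2 0 ∈ I ^ 3 := by
  have : lineProduct x y z 4 0 0 1 2 0 =
      y * (x * (y ^ 2 - z ^ 2) * (x * (y ^ 2 - z ^ 2)) * (y * (z ^ 2 - x ^ 2))) +
      x * (x * (y ^ 2 - z ^ 2) * (y * (z ^ 2 - x ^ 2)) * (y * (z ^ 2 - x ^ 2))) +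
      -x * (x * (y ^ 2 - z ^ 2) * (z * (x ^ 2 - y ^ 2)) * (z * (x ^ 2 - y ^ 2))) := by
    unfold lineProduct; ring
  rw [this]
  apply_rules [add_mem, Ideal.mul_mul_mem_pow_three]

theorem cubic_mem_three (hf : x * (y ^ 2 - z ^ 2) ∈ I) (hg : y * (z ^ 2 - x ^ 2) ∈ I)
    (hh : z * (x ^ 2 - y ^ 2) ∈ I) : lineProduct x y z 4 0 0 0 2 1 ∈ I ^ 3 := by
  have : lineProduct x y z 4 0 0 0 2 1 =
      -x * (x * (y ^ 2 - z ^ 2) * (y * (z ^ 2 - x ^ 2)) * (y * (z ^ 2 - x ^ 2))) +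
      x * (x * (y ^ 2 - z ^ 2) * (z * (x ^ 2 - y ^ 2)) * (z * (x ^ 2 - y ^ 2))) +
      z * (x * (y ^ 2 - z ^ 2) * (x * (y ^ 2 - z ^ 2)) * (z * (x ^ 2 - y ^ 2))) := by
    unfold lineProduct; ring
  rw [this]
  apply_rules [add_mem, Ideal.mul_mul_mem_pow_three]

theorem quartic_pow_mem (hf : x * (y ^ 2 - z ^ 2) ∈ I) (hg : y * (z ^ 2 - x ^ 2) ∈ I) (n : ℕ) :
    lineProduct x y z n n 0 n 0 0 ∈ I ^ n := by
  have : lineProduct x y z n n 0 n 0 0 =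
      (-y * (x * (y ^ 2 - z ^ 2)) - x * (y * (z ^ 2 - x ^ 2))) ^ n := by
    rw [show -y * (x * (y ^ 2 - z ^ 2)) - x * (y * (z ^ 2 - x ^ 2)) = x * y * (x ^ 2 - y ^ 2) by
      ring]
    simp only [lineProduct, mul_pow]; ring
  rw [this]
  exact Ideal.pow_mem_pow (sub_mem (Ideal.mul_mem_left _ _ hf) (Ideal.mul_mem_left _ _ hg)) _

theorem lineProduct_mem_of_two_le (hf : x * (y ^ 2 - z ^ 2) ∈ I) (hg : y * (z ^ 2 - x ^ 2) ∈ I)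
    (hh : z * (x ^ 2 - y ^ 2) ∈ I) {A B C d e f m r : ℕ} (h1 : m ≤ B + C + 2 * e)
    (h2 : m ≤ A + C + 2 * f) (h0 : m ≤ d + e + f) (hr : 1 ≤ r)
    (hm : 2 * r ≤ m + 2) (hmr : 2 * r ≤ m + 1 ∨ 3 ≤ r) (hA : e ≤ A) (hB : f ≤ B) :
    lineProduct x y z A B C d e f ∈ I ^ r := by
  by_cases hC : d ≤ C
  · exact lineProduct_mem_of_le_pow hf hg hh (n := 0) hA le_rfl hB le_rfl hC le_rfl (by omega)
  obtain ⟨n, hn⟩ : ∃ n, n = min (min (A - e) (B - f)) (d - C) := ⟨_, rfl⟩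
  by_cases hS : r ≤ e + f + C + n
  · exact Ideal.pow_le_pow_right hS (lineProduct_mem_of_le hf hg hh hA le_rfl hB le_rfl le_rfl
      (by omega) (lineProduct_mono (quartic_pow_mem hf hg n) (by omega) (by omega) (by omega)
        (by omega) (by omega) (by omega)))
  -- If n = d - C, the bound m ≤ d + e + f contradicts `hS`. If n = A - e, then `h2` forces A = C =
  -- e = 0, f = r - 1 and m = 2r - 2, hence r ≥ 3; the case n = B - f is symmetric.
  have hcase : (r = 3 + (r - 3) ∧ e = 0 ∧ C = 0 ∧ f = r - 1 ∧ r + 1 ≤ B ∧ 1 ≤ d) ∨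
      (r = 3 + (r - 3) ∧ f = 0 ∧ C = 0 ∧ e = r - 1 ∧ r + 1 ≤ A ∧ 1 ≤ d) := by omega
  rcases hcase with ⟨h3, he, hC0, hf0, hB0, hd⟩ | ⟨h3, he, hC0, hf0, hB0, hd⟩
  · have hmem : lineProduct x y z 0 4 0 1 0 2 ∈ I ^ 3 := by
      rw [lineProduct_rotate]; exact cubic_mem_three hg hh hf
    exact Ideal.pow_le_pow_right (by omega) (lineProduct_mem_of_le hf hg hh (i := 0) (j := r - 3)
      (k := 0) (by omega) (by omega) (by omega) (by omega) (by omega) (by omega)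
      (lineProduct_mono hmem (by omega) (by omega) (by omega)
        (by omega) (by omega) (by omega)))
  · exact Ideal.pow_le_pow_right (by omega) (lineProduct_mem_of_le hf hg hh (i := r - 3) (j := 0)
      (k := 0) (by omega) (by omega) (by omega) (by omega) (by omega) (by omega)
      (lineProduct_mono (cubic_mem_two hf hg hh) (by omega) (by omega) (by omega)
        (by omega) (by omega) (by omega)))

theorem lineProduct_mem_of_one_le (hf : x * (y ^ 2 - z ^ 2) ∈ I) (hg : y * (z ^ 2 - x ^ 2) ∈ I)
    (hh : z * (x ^ 2 - y ^ 2) ∈ I) {A B C d e f m r : ℕ} (h1 : m ≤ B + C + 2 * e)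
    (h2 : m ≤ A + C + 2 * f) (h3 : m ≤ A + B + 2 * d) (h0 : m ≤ d + e + f) (hr : 1 ≤ r)
    (hm : 2 * r ≤ m + 2) (hmr : 2 * r ≤ m + 1 ∨ 3 ≤ r) (hA : e ≤ A) :
    lineProduct x y z A B C d e f ∈ I ^ r := by
  by_cases hB : f ≤ B
  · exact lineProduct_mem_of_two_le hf hg hh h1 h2 h0 hr hm hmr hA hB
  by_cases hC : d ≤ C
  · rw [lineProduct_rotate, lineProduct_rotate]
    exact lineProduct_mem_of_two_le hh hf hg (m := m) (by omega) (by omega) (by omega) hr hm hmr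
      hC hA
  by_cases hS : r ≤ e + B + C
  · exact lineProduct_mem_of_le_pow hf hg hh (n := 0) hA le_rfl le_rfl (by omega) le_rfl (by omega)
      (by omega)
  -- The failure of `hS` together with `h1` forces B = C = 0, e = r - 1 and m = 2r - 2.
  exact Ideal.pow_le_pow_right (show r ≤ r - 3 + 0 + 0 + 3 by omega)
    (lineProduct_mem_of_le hf hg hh (i := r - 3) (j := 0)
      (k := 0) (by omega) (by omega) (by omega) (by omega) (by omega) (by omega)
      (lineProduct_mono (cubic_mem_one hf hg hh) (by omega) (by omega) (by omega)
        (by omega) (by omega) (by omega)))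

theorem lineProduct_mem_of_min (hf : x * (y ^ 2 - z ^ 2) ∈ I) (hg : y * (z ^ 2 - x ^ 2) ∈ I)
    (hh : z * (x ^ 2 - y ^ 2) ∈ I) {A B C d e f m r : ℕ} (h1 : m ≤ B + C + 2 * e)
    (h2 : m ≤ A + C + 2 * f) (h3 : m ≤ A + B + 2 * d)
    (hm : 2 * r ≤ m + 2) (hmr : 2 * r ≤ m + 1 ∨ 3 ≤ r) (hC : C < d)
    (hA : d - C ≤ e - A) (hB : d - C ≤ f - B) :
    lineProduct x y z A B C d e f ∈ I ^ r := by
  by_cases hS : r ≤ A + B + C + (2 * (d - C) - 1)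
  · exact lineProduct_mem_of_le_pow hf hg hh (n := d - C) le_rfl (by omega) le_rfl (by omega) le_rfl
      (by omega) hS
  -- Here `h3` forces A = B = 0, C = r - 2, d = r - 1. Removing r - 3 copies of the third generator
  -- leaves a multiple of z times the square of the six lines.
  have hF : lineProduct x y z 0 0 1 2 2 2 ∈ I ^ 4 :=
    lineProduct_mono (sixLines_sq_mem hf hg hh) le_rfl le_rfl (by omega) le_rfl le_rfl le_rfl
  exact Ideal.pow_le_pow_right (show r ≤ 0 + 0 + (r - 3) + 4 by omega)
    (lineProduct_mem_of_le hf hg hh (i := 0) (j := 0)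
      (k := r - 3) (by omega) (by omega) (by omega) (by omega) (by omega) (by omega)
      (lineProduct_mono hF (by omega) (by omega) (by omega)
        (by omega) (by omega) (by omega)))

/-- A product of lines that vanishes to order `m` at the seven points lies in `I ^ r`
if `m ≥ 2r - 1`, or if `m ≥ 2r - 2` and `r ≥ 3`. -/
theorem lineProduct_mem_pow (hf : x * (y ^ 2 - z ^ 2) ∈ I) (hg : y * (z ^ 2 - x ^ 2) ∈ I)
    (hh : z * (x ^ 2 - y ^ 2) ∈ I) {A B C d e f m r : ℕ} (h1 : m ≤ B + C + 2 * e)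
    (h2 : m ≤ A + C + 2 * f) (h3 : m ≤ A + B + 2 * d) (h0 : m ≤ d + e + f) (hr : 1 ≤ r)
    (hm : 2 * r ≤ m + 2) (hmr : 2 * r ≤ m + 1 ∨ 3 ≤ r) :
    lineProduct x y z A B C d e f ∈ I ^ r := by
  by_cases hA : e ≤ A
  · exact lineProduct_mem_of_one_le hf hg hh h1 h2 h3 h0 hr hm hmr hA
  by_cases hB : f ≤ B
  · rw [lineProduct_rotate]
    exact lineProduct_mem_of_one_le hg hh hf (m := m) (by omega) (by omega) (by omega) (by omega)
      hr hm hmr hB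
  by_cases hC : d ≤ C
  · rw [lineProduct_rotate, lineProduct_rotate]
    exact lineProduct_mem_of_one_le hh hf hg (m := m) (by omega) (by omega) (by omega) (by omega)
      hr hm hmr hC
  have hmin : (d - C ≤ e - A ∧ d - C ≤ f - B) ∨ (e - A ≤ f - B ∧ e - A ≤ d - C) ∨
      (f - B ≤ d - C ∧ f - B ≤ e - A) := by omega
  rcases hmin with h | h | h
  · exact lineProduct_mem_of_min hf hg hh h1 h2 h3 hm hmr (by omega) h.1 h.2
  · rw [lineProduct_rotate]
    exact lineProduct_mem_of_min hg hh hf (m := m) (by omega) (by omega) (by omega)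
      hm hmr (by omega) h.1 h.2
  · rw [lineProduct_rotate, lineProduct_rotate]
    exact lineProduct_mem_of_min hh hf hg (m := m) (by omega) (by omega) (by omega)
      hm hmr (by omega) h.1 h.2

end Products

/-! ### Surplus degree in ideals generated in one degree. -/

section Homogeneous

open scoped Pointwise

open MvPolynomial

variable {σ R : Type*} [CommRing R]

theorem homogeneousComponent_mul_of_isHomogeneous {g : MvPolynomial σ R} {k : ℕ}
    (hg : g.IsHomogeneous k) (s : MvPolynomial σ R) (n : ℕ) :
    homogeneousComponent n (s * g) = if k ≤ n then homogeneousComponent (n - k) s * g else 0 := by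
  conv_lhs => rw [← sum_homogeneousComponent s, Finset.sum_mul, map_sum]
  have h1 (i : ℕ) : homogeneousComponent n (homogeneousComponent i s * g) =
      if n = i + k then homogeneousComponent i s * g else 0 :=
    homogeneousComponent_of_mem ((homogeneousComponent_isHomogeneous i s).mul hg)
  simp only [h1]
  split_ifs with hk
  · rw [Finset.sum_eq_single (n - k)]
    · rw [if_pos (by omega)]
    · intro i _ hi; rw [if_neg (by omega)]
    · intro hi
      rw [homogeneousComponent_eq_zero _ _ (by simp at hi; omega)]; simp
  · exact Finset.sum_eq_zero fun i _ => if_neg (by omega)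

theorem mem_pow_idealOfVars_mul_span {S : Set (MvPolynomial σ R)} {k : ℕ}
    (hS : ∀ g ∈ S, g.IsHomogeneous k) {p : MvPolynomial σ R} (hp : p ∈ Ideal.span S) {n : ℕ}
    (hn : p.IsHomogeneous n) {l : ℕ} (hl : l + k ≤ n) :
    p ∈ idealOfVars σ R ^ l * Ideal.span S := by
  have key : ∀ a : MvPolynomial σ R, homogeneousComponent n (a * p) ∈
      idealOfVars σ R ^ l * Ideal.span S := by
    clear hn
    induction hp using Submodule.span_induction with
    | mem g hg =>
      intro a
      rw [homogeneousComponent_mul_of_isHomogeneous (hS g hg), if_pos (by omega)]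
      refine Ideal.mul_mem_mul ?_ (Ideal.subset_span hg)
      rw [mem_pow_idealOfVars_iff']
      intro d hd
      exact (homogeneousComponent_isHomogeneous (n - k) a).coeff_eq_zero (by omega)
    | zero => intro a; simp
    | add x y _ _ hx hy => intro a; rw [mul_add, map_add]; exact add_mem (hx a) (hy a)
    | smul b x _ hx => intro a; rw [smul_eq_mul, ← mul_assoc]; exact hx _
  have := key 1
  rwa [one_mul, homogeneousComponent_eq_self hn] at this

theorem mem_pow_idealOfVars_mul_span_pow {S : Set (MvPolynomial σ R)} {k : ℕ}
    (hS : ∀ g ∈ S, g.IsHomogeneous k) {r : ℕ} {p : MvPolynomial σ R} (hp : p ∈ Ideal.span S ^ r)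
    {n : ℕ} (hn : p.IsHomogeneous n) {l : ℕ} (hl : l + k * r ≤ n) :
    p ∈ idealOfVars σ R ^ l * Ideal.span S ^ r := by
  have hpow : Ideal.span S ^ r = Ideal.span (S ^ r) := Submodule.span_pow S r
  rw [hpow] at hp ⊢
  refine mem_pow_idealOfVars_mul_span ?_ hp hn hl
  clear hp hpow hl
  induction r with
  | zero =>
    intro g hg
    rw [pow_zero, Set.mem_one] at hg
    rw [hg, mul_zero]; exact isHomogeneous_one σ R
  | succ r ih =>
    intro g hg
    rw [pow_succ] at hg
    obtain ⟨a, ha, b, hb, rfl⟩ := hg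
    exact (ih a ha).mul (hS b hb)

end Homogeneous

/-! ### Symbolic powers and orders along ring homomorphisms. -/

section Symbolic

/-- An element of the `m`-th symbolic power has order at least `m` along every ring homomorphism
that is centred at a minimal prime of the ideal. -/
theorem Ideal.pow_dvd_of_mem_symbolicPower {R S : Type*} [CommRing R] [IsNoetherianRing R]
    [CommRing S] [IsDomain S] {I Q : Ideal R} (hQ : Q ∈ I.minimalPrimes) (ψ : R →+* S) {π : S}
    (hπ : Prime π) (hI : ∀ a ∈ I, π ∣ ψ a) (hψ : ∀ a, π ∣ ψ a → a ∈ Q) {m : ℕ} {p : R}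
    (hp : p ∈ I.symbolicPower m) : π ^ m ∣ ψ p := by
  have hass : Q ∈ associatedPrimes R (R ⧸ I) := by
    apply Module.associatedPrimes.minimalPrimes_annihilator_subset_associatedPrimes
    rwa [Ideal.annihilator_quotient]
  have hp' := (Ideal.mem_iInf.mp hp) ⟨Q, hass⟩
  have : Q.IsPrime := hQ.1.1
  rw [Ideal.mem_comap, IsLocalization.algebraMap_mem_map_algebraMap_iff Q.primeCompl] at hp'
  obtain ⟨s, hs, hsp⟩ := hp'
  have hle : (I ^ m).map ψ ≤ Ideal.span {π ^ m} := by
    rw [Ideal.map_pow, ← Ideal.span_singleton_pow]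
    refine Ideal.pow_right_mono ?_ m
    rw [Ideal.map_le_iff_le_comap]
    intro a ha
    exact Ideal.mem_span_singleton.mpr (hI a ha)
  have hd := Ideal.mem_span_singleton.mp (hle (Ideal.mem_map_of_mem ψ hsp))
  rw [map_mul] at hd
  exact hπ.pow_dvd_of_dvd_mul_left m (fun h => hs (hψ s h)) hd

/-- Two algebra homomorphisms that agree on the variables modulo an ideal agree modulo it. -/
theorem MvPolynomial.aeval_sub_aeval_mem {σ K A : Type*} [CommRing K] [CommRing A] [Algebra K A]
    (J : Ideal A) {s t : σ → A} (h : ∀ i, s i - t i ∈ J) (p : MvPolynomial σ K) :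
    aeval s p - aeval t p ∈ J := by
  rw [← Ideal.Quotient.eq]
  have : (Ideal.Quotient.mkₐ K J).comp (aeval s) = (Ideal.Quotient.mkₐ K J).comp (aeval t) := by
    ext i
    simpa [Ideal.Quotient.eq] using h i
  exact DFunLike.congr_fun this p

end Symbolic

/-! ### Orders at the seven points. -/

section Orders

open MvPolynomial

variable {K : Type*} [Field K]

theorem Fin.exists_ne_and_ne_of_three : ∀ i k : Fin 3, ∃ j, j ≠ i ∧ j ≠ k := by decide

theorem fermatIdeal_two_mem {i j k : Fin 3} (hij : i ≠ j) (hjk : j ≠ k) (hik : i ≠ k) :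
    (X i * (X j ^ 2 - X k ^ 2) : MvPolynomial (Fin 3) K) ∈ fermatIdeal K 2 := by
  have h0 : (X 0 * (X 1 ^ 2 - X 2 ^ 2) : MvPolynomial (Fin 3) K) ∈ fermatIdeal K 2 :=
    Ideal.subset_span (by simp)
  have h1 : (X 1 * (X 2 ^ 2 - X 0 ^ 2) : MvPolynomial (Fin 3) K) ∈ fermatIdeal K 2 :=
    Ideal.subset_span (by simp)
  have h2 : (X 2 * (X 0 ^ 2 - X 1 ^ 2) : MvPolynomial (Fin 3) K) ∈ fermatIdeal K 2 :=
    Ideal.subset_span (by simp)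
  have hneg (a b c : MvPolynomial (Fin 3) K) (h : a * (b - c) ∈ fermatIdeal K 2) :
      a * (c - b) ∈ fermatIdeal K 2 := by
    rw [← neg_sub b c, mul_neg]; exact neg_mem h
  fin_cases i <;> fin_cases j <;> fin_cases k <;>
    first
    | exact absurd rfl hij
    | exact absurd rfl hjk
    | exact absurd rfl hik
    | assumption
    | exact hneg _ _ _ (by assumption)

theorem fermatIdeal_two_le {J : Ideal (MvPolynomial (Fin 3) K)}
    (h : ∀ i j k : Fin 3, i ≠ j → j ≠ k → i ≠ k → X i * (X j ^ 2 - X k ^ 2) ∈ J) :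
    fermatIdeal K 2 ≤ J := by
  unfold fermatIdeal
  rw [Ideal.span_le]
  rintro a (rfl | rfl | rfl)
  · exact h 0 1 2 (by decide) (by decide) (by decide)
  · exact h 1 2 0 (by decide) (by decide) (by decide)
  · exact h 2 0 1 (by decide) (by decide) (by decide)

/-- Here `t` parametrizes the line over one of the points, whose prime is the kernel of `aeval t`. A
prime J between I and this kernel contains every X i - t i, so every q is congruent to `aeval t q`
modulo J; this gives minimality. -/
theorem pow_dvd_of_center {S : Type*} [CommRing S] [IsDomain S] {I : Ideal (MvPolynomial (Fin 3) K)}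
    (t : Fin 3 → MvPolynomial (Fin 3) K) (ψ : MvPolynomial (Fin 3) K →+* S) {π : S} (hπ : Prime π)
    (hI : ∀ a ∈ I, π ∣ ψ a) (hψ : ∀ a, π ∣ ψ a → aeval t a = 0)
    (ht : ∀ J : Ideal (MvPolynomial (Fin 3) K), J.IsPrime → I ≤ J →
      J ≤ RingHom.ker (aeval t : _ →ₐ[K] MvPolynomial (Fin 3) K) → ∀ i, X i - t i ∈ J)
    {m : ℕ} {p : MvPolynomial (Fin 3) K} (hp : p ∈ I.symbolicPower m) : π ^ m ∣ ψ p := by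
  refine Ideal.pow_dvd_of_mem_symbolicPower
    (Q := RingHom.ker (aeval t : _ →ₐ[K] MvPolynomial (Fin 3) K)) ?_ ψ hπ hI hψ hp
  refine ⟨⟨RingHom.ker_isPrime _, fun a ha => hψ a (hI a ha)⟩, ?_⟩
  rintro J ⟨hJ, hIJ⟩ hJQ q hq
  have h1 := aeval_sub_aeval_mem J (ht J hJ hIJ hJQ) q
  rw [show aeval t q = 0 from hq, sub_zero, aeval_X_left_apply] at h1
  exact h1

/-- The substitution `X i ↦ X i * T ^ w i`. -/
noncomputable def weightHom (K : Type*) [Field K] (w : Fin 3 → ℕ) :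
    MvPolynomial (Fin 3) K →ₐ[K] Polynomial (MvPolynomial (Fin 3) K) :=
  aeval fun i => Polynomial.C (X i) * Polynomial.X ^ w i

/-- The substitution `x ↦ z + T a`, `y ↦ z + T b`, `z ↦ z` into the coordinates
`c 0 * x`, `c 1 * y`, `c 2 * z`. -/
noncomputable def pointHom (c : Fin 3 → K) :
    MvPolynomial (Fin 3) K →ₐ[K] Polynomial (MvPolynomial (Fin 3) K) :=
  aeval fun i => Polynomial.C (C (c i)) *
    (Polynomial.C (X 2) + Polynomial.X * Polynomial.C (![X 0, X 1, 0] i))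

theorem coeff_zero_aeval {σ A : Type*} [CommRing A] [Algebra K A] (s : σ → Polynomial A)
    (p : MvPolynomial σ K) :
    (aeval s p).coeff 0 = aeval (fun i => (s i).coeff 0) p := by
  have : ((Polynomial.aeval (0 : A)).restrictScalars K).comp (aeval s) =
      aeval (R := K) (fun i => (s i).coeff 0) := by
    ext i
    simp [Polynomial.coeff_zero_eq_eval_zero]
  rw [← this, Polynomial.coeff_zero_eq_eval_zero]
  simp

theorem pow_dvd_weightHom_of_mem_symbolicPower (k : Fin 3) {m : ℕ} {p : MvPolynomial (Fin 3) K}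
    (hp : p ∈ (fermatIdeal K 2).symbolicPower m) :
    Polynomial.X ^ m ∣ weightHom K (fun i => if i = k then 0 else 1) p := by
  have hcoeff (a : MvPolynomial (Fin 3) K) :
      Polynomial.X ∣ weightHom K (fun i => if i = k then 0 else 1) a ↔
        aeval (fun i => if i = k then X k else 0 : Fin 3 → MvPolynomial (Fin 3) K) a = 0 := by
    rw [Polynomial.X_dvd_iff, weightHom, coeff_zero_aeval]
    have : (fun i => (Polynomial.C (X i) * Polynomial.X ^ (if i = k then 0 else 1) :
        Polynomial (MvPolynomial (Fin 3) K)).coeff 0) = fun i => if i = k then X k else 0 := by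
      ext1 i
      split_ifs with h <;> simp [h]
    rw [this]
  refine pow_dvd_of_center (fun i => if i = k then X k else 0)
    (weightHom K (fun i => if i = k then 0 else 1)).toRingHom Polynomial.prime_X ?_
    (fun a ha => (hcoeff a).mp ha) ?_ hp
  · intro a ha
    refine (hcoeff a).mpr ?_
    revert a
    change fermatIdeal K 2 ≤ RingHom.ker (aeval (fun i => if i = k then X k else 0 :
      Fin 3 → MvPolynomial (Fin 3) K))
    refine fermatIdeal_two_le fun i j l hij hjl hil => ?_
    rw [RingHom.mem_ker]
    simp only [map_mul, map_sub, map_pow, aeval_X]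
    split_ifs <;> simp_all
  · intro J hJ hIJ hJQ i
    split_ifs with h
    · rw [h, sub_self]; exact zero_mem _
    · obtain ⟨j, hj1, hj2⟩ : ∃ j, j ≠ i ∧ j ≠ k := Fin.exists_ne_and_ne_of_three i k
      rw [sub_zero]
      refine (hJ.mem_or_mem (hIJ (fermatIdeal_two_mem hj1.symm hj2 h))).resolve_right fun hc => ?_
      have := hJQ hc
      rw [RingHom.mem_ker] at this
      simp [hj2] at this

theorem pow_dvd_pointHom_of_mem_symbolicPower [CharZero K] {c : Fin 3 → K} (hc : ∀ i, c i ≠ 0)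
    (hcc : ∀ i j, c i ^ 2 = c j ^ 2) {m : ℕ} {p : MvPolynomial (Fin 3) K}
    (hp : p ∈ (fermatIdeal K 2).symbolicPower m) :
    Polynomial.X ^ m ∣ pointHom c p := by
  have hcoeff (a : MvPolynomial (Fin 3) K) :
      Polynomial.X ∣ pointHom c a ↔
        aeval (fun i => C (c i) * X 2 : Fin 3 → MvPolynomial (Fin 3) K) a = 0 := by
    rw [Polynomial.X_dvd_iff, pointHom, coeff_zero_aeval]
    simp
  -- Division by `c 2` normalizes the last coordinate to X 2, so that X i - t i can lie in J for i =
  -- 2.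
  refine pow_dvd_of_center (fun i => C (c i / c 2) * X 2)
    (pointHom c).toRingHom Polynomial.prime_X ?_ ?_ ?_ hp
  · intro a ha
    refine (hcoeff a).mpr ?_
    revert a
    change fermatIdeal K 2 ≤ RingHom.ker (aeval (fun i => C (c i) * X 2 :
      Fin 3 → MvPolynomial (Fin 3) K))
    refine fermatIdeal_two_le fun i j l hij hjl hil => ?_
    rw [RingHom.mem_ker]
    have h1 : (C (c j) ^ 2 : MvPolynomial (Fin 3) K) = C (c l) ^ 2 := by
      rw [← C_pow, ← C_pow, hcc j l]
    simp only [map_mul, map_sub, map_pow, aeval_X, mul_pow, h1, sub_self, mul_zero]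
  · intro a ha
    have h0 := congrArg (aeval (fun i => C (c 2)⁻¹ * X i : Fin 3 → MvPolynomial (Fin 3) K))
      ((hcoeff a).mp ha)
    rw [map_zero, ← AlgHom.comp_apply, comp_aeval] at h0
    rw [← h0]
    congr 2
    ext1 i
    rw [map_mul, aeval_X, algHom_C, algebraMap_eq, div_eq_mul_inv, C_mul, mul_assoc]
  · intro J hJ hIJ hJQ i
    have hX (i : Fin 3) : (X i : MvPolynomial (Fin 3) K) ∉ J := by
      intro h
      have := hJQ h
      rw [RingHom.mem_ker] at this
      simp [hc] at this
    have hsq (i j : Fin 3) : (X i ^ 2 - X j ^ 2 : MvPolynomial (Fin 3) K) ∈ J := by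
      by_cases hij : i = j
      · rw [hij, sub_self]; exact zero_mem _
      obtain ⟨k, hk1, hk2⟩ : ∃ k, k ≠ i ∧ k ≠ j := Fin.exists_ne_and_ne_of_three i j
      exact (hJ.mem_or_mem (hIJ (fermatIdeal_two_mem hk1 hij hk2))).resolve_left (hX k)
    have h1 : (C (c i / c 2) ^ 2 : MvPolynomial (Fin 3) K) = 1 := by
      rw [← C_pow, div_pow, hcc i 2, div_self (pow_ne_zero 2 (hc 2)), C_1]
    have h2 : (X i - C (c i / c 2) * X 2) * (X i + C (c i / c 2) * X 2) ∈ J := by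
      have : (X i - C (c i / c 2) * X 2) * (X i + C (c i / c 2) * X 2) =
        (X i ^ 2 - C (c i / c 2) ^ 2 * X 2 ^ 2 : MvPolynomial (Fin 3) K) := by ring
      rw [this, h1, one_mul]
      exact hsq i 2
    -- On the line the other factor equals 2 (c i / c 2) X 2, which is nonzero in characteristic 0.
    refine (hJ.mem_or_mem h2).resolve_right fun h3 => ?_
    have := hJQ h3
    rw [RingHom.mem_ker] at this
    simp [hc, ← two_mul] at this

end Orders

/-! ### Order conditions at four points of the plane with coordinates u, v, w. -/

section FatPoints

open MvPolynomial

variable {K : Type*} [Field K]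

theorem weightHom_monomial (w : Fin 3 → ℕ) (n : Fin 3 →₀ ℕ) (a : K) :
    weightHom K w (monomial n a) = Polynomial.C (monomial n a) * Polynomial.X ^ ∑ i, n i * w i := by
  rw [weightHom, aeval_monomial, Finsupp.prod_fintype _ _ (by simp), monomial_eq,
    Finsupp.prod_fintype _ _ (by simp)]
  simp only [mul_pow, Finset.prod_mul_distrib, ← pow_mul, Finset.prod_pow_eq_pow_sum, map_mul,
    map_prod, map_pow, mul_comm (w _)]
  rw [mul_assoc]
  rfl

theorem coeff_coeff_weightHom (w : Fin 3 → ℕ) (p : MvPolynomial (Fin 3) K) (d : Fin 3 →₀ ℕ)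
    (k : ℕ) :
    ((weightHom K w p).coeff k).coeff d = if ∑ i, d i * w i = k then p.coeff d else 0 := by
  induction p using MvPolynomial.induction_on' with
  | monomial n a =>
    rw [weightHom_monomial, Polynomial.coeff_C_mul, Polynomial.coeff_X_pow, mul_ite, mul_one,
      mul_zero, coeff_monomial]
    by_cases h : n = d
    · subst h
      simp [apply_ite (coeff n), eq_comm]
    · simp [apply_ite (coeff d), coeff_monomial, h]
  | add p q hp hq =>
    rw [map_add, Polynomial.coeff_add, coeff_add, hp, hq, coeff_add]
    split_ifs <;> simp

/-- No cancellation occurs between monomials, so these conditions pass to every polynomial with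
smaller support. -/
theorem pow_dvd_weightHom_iff (w : Fin 3 → ℕ) {m : ℕ} {p : MvPolynomial (Fin 3) K} :
    Polynomial.X ^ m ∣ weightHom K w p ↔ ∀ n ∈ p.support, m ≤ ∑ i, n i * w i := by
  constructor
  · intro h n hn
    by_contra! hlt
    have h1 := coeff_coeff_weightHom w p n (∑ i, n i * w i)
    rw [if_pos rfl, Polynomial.X_pow_dvd_iff.mp h _ hlt, coeff_zero] at h1
    exact (mem_support_iff.mp hn) h1.symm
  · intro h
    rw [p.as_sum, map_sum]
    refine Finset.dvd_sum fun n hn => ?_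
    rw [weightHom_monomial]
    exact Dvd.dvd.mul_left (pow_dvd_pow _ (h n hn)) _

theorem pow_sub_dvd_of_dvd_mul {A : Type*} [CommRing A] [IsDomain A] {u g : Polynomial A}
    {m k : ℕ} (h : Polynomial.X ^ m ∣ Polynomial.X ^ k * u * g) (hu : ¬ Polynomial.X ∣ u) :
    Polynomial.X ^ (m - k) ∣ g := by
  rcases le_total m k with hk | hk
  · rw [Nat.sub_eq_zero_of_le hk, pow_zero]; exact one_dvd _
  · rw [← Nat.add_sub_cancel' hk, pow_add, mul_assoc] at h
    have := (mul_dvd_mul_iff_left (pow_ne_zero k Polynomial.X_ne_zero)).mp h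
    exact Polynomial.prime_X.pow_dvd_of_dvd_mul_left _ hu this

/-- The weights that describe the order at the `k`-th coordinate point. -/
def coordWeight (k i : Fin 3) : ℕ := if i = k then 0 else 1

/-- The product `u^a v^b w^c (u-v)^d (v-w)^e (w-u)^f` in `K[u, v, w]`. -/
noncomputable def diffProduct (K : Type*) [Field K] (a b c d e f : ℕ) : MvPolynomial (Fin 3) K :=
  X 0 ^ a * X 1 ^ b * X 2 ^ c * (X 0 - X 1) ^ d * (X 1 - X 2) ^ e * (X 2 - X 0) ^ f

/-- The products of degree `t` of the six lines through pairs of the four points `(1,1,1)` and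
`(1,0,0)`, `(0,1,0)`, `(0,0,1)` which have multiplicities `m₀, m₁, m₂, m₃` at these points. -/
def diffProducts (K : Type*) [Field K] (t m₀ m₁ m₂ m₃ : ℕ) : Set (MvPolynomial (Fin 3) K) :=
  {q | ∃ a b c d e f : ℕ, a + b + c + d + e + f = t ∧ m₀ ≤ d + e + f ∧ m₁ ≤ b + c + e ∧
    m₂ ≤ a + c + f ∧ m₃ ≤ a + b + d ∧ q = diffProduct K a b c d e f}

/-- The order conditions `m₀, m₁, m₂, m₃` at the points `(1,1,1)`, `(1,0,0)`, `(0,1,0)`, `(0,0,1)`;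
the first one is stated after the substitution of squares for the variables. -/
structure HasOrders (m₀ m₁ m₂ m₃ : ℕ) (q : MvPolynomial (Fin 3) K) : Prop where
  one : Polynomial.X ^ m₀ ∣ pointHom 1 (expand 2 q)
  fst : Polynomial.X ^ m₁ ∣ weightHom K (coordWeight 0) q
  snd : Polynomial.X ^ m₂ ∣ weightHom K (coordWeight 1) q
  trd : Polynomial.X ^ m₃ ∣ weightHom K (coordWeight 2) q

theorem isHomogeneous_diffProduct (a b c d e f : ℕ) :
    (diffProduct K a b c d e f).IsHomogeneous (a + b + c + d + e + f) := by
  have h (i : Fin 3) (n : ℕ) : (X i ^ n : MvPolynomial (Fin 3) K).IsHomogeneous n :=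
    isHomogeneous_X_pow i n
  have h' (i j : Fin 3) (n : ℕ) : ((X i - X j) ^ n : MvPolynomial (Fin 3) K).IsHomogeneous n := by
    simpa using ((isHomogeneous_X K i).sub (isHomogeneous_X K j)).pow n
  exact (((((h 0 a).mul (h 1 b)).mul (h 2 c)).mul (h' 0 1 d)).mul (h' 1 2 e)).mul (h' 2 0 f)

theorem isHomogeneous_of_mem_span_diffProducts {t m₀ m₁ m₂ m₃ : ℕ} {q : MvPolynomial (Fin 3) K}
    (hq : q ∈ Submodule.span K (diffProducts K t m₀ m₁ m₂ m₃)) : q.IsHomogeneous t := by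
  have : Submodule.span K (diffProducts K t m₀ m₁ m₂ m₃) ≤ homogeneousSubmodule (Fin 3) K t := by
    rw [Submodule.span_le]
    rintro _ ⟨a, b, c, d, e, f, rfl, -, -, -, -, rfl⟩
    exact isHomogeneous_diffProduct a b c d e f
  exact this hq

theorem pow_dvd_map_diffProduct {A : Type*} [CommRing A] (ψ : MvPolynomial (Fin 3) K →+* A) {π : A}
    {a b c d e f κa κb κc κd κe κf m : ℕ} (ha : π ^ κa ∣ ψ (X 0)) (hb : π ^ κb ∣ ψ (X 1))
    (hc : π ^ κc ∣ ψ (X 2)) (hd : π ^ κd ∣ ψ (X 0 - X 1)) (he : π ^ κe ∣ ψ (X 1 - X 2))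
    (hf : π ^ κf ∣ ψ (X 2 - X 0))
    (hm : m ≤ κa * a + κb * b + κc * c + κd * d + κe * e + κf * f) :
    π ^ m ∣ ψ (diffProduct K a b c d e f) := by
  refine (pow_dvd_pow π hm).trans ?_
  simp only [diffProduct, map_mul, map_pow, pow_add, pow_mul]
  exact mul_dvd_mul (mul_dvd_mul (mul_dvd_mul (mul_dvd_mul (mul_dvd_mul (pow_dvd_pow_of_dvd ha a)
    (pow_dvd_pow_of_dvd hb b)) (pow_dvd_pow_of_dvd hc c)) (pow_dvd_pow_of_dvd hd d))
    (pow_dvd_pow_of_dvd he e)) (pow_dvd_pow_of_dvd hf f)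

theorem weightHom_coordWeight_X (k i : Fin 3) : weightHom K (coordWeight k) (X i) =
    Polynomial.C (X i) * Polynomial.X ^ coordWeight k i := by
  rw [weightHom, aeval_X]

theorem pointHom_one_expand_X (i : Fin 3) : pointHom (1 : Fin 3 → K) (expand 2 (X i)) =
    (Polynomial.C (X 2) + Polynomial.X * Polynomial.C (![X 0, X 1, 0] i)) ^ 2 := by
  rw [expand_X, map_pow, pointHom, aeval_X]
  simp

theorem HasOrders.add {m₀ m₁ m₂ m₃ : ℕ} {p q : MvPolynomial (Fin 3) K}
    (hp : HasOrders m₀ m₁ m₂ m₃ p) (hq : HasOrders m₀ m₁ m₂ m₃ q) :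
    HasOrders m₀ m₁ m₂ m₃ (p + q) :=
  ⟨by rw [map_add, map_add]; exact dvd_add hp.one hq.one,
   by rw [map_add]; exact dvd_add hp.fst hq.fst, by rw [map_add]; exact dvd_add hp.snd hq.snd,
   by rw [map_add]; exact dvd_add hp.trd hq.trd⟩

theorem HasOrders.smul {m₀ m₁ m₂ m₃ : ℕ} {p : MvPolynomial (Fin 3) K}
    (hp : HasOrders m₀ m₁ m₂ m₃ p) (c : K) : HasOrders m₀ m₁ m₂ m₃ (c • p) :=
  ⟨by rw [map_smul, map_smul]; exact dvd_smul_of_dvd c hp.one,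
   by rw [map_smul]; exact dvd_smul_of_dvd c hp.fst,
   by rw [map_smul]; exact dvd_smul_of_dvd c hp.snd,
   by rw [map_smul]; exact dvd_smul_of_dvd c hp.trd⟩

theorem hasOrders_diffProduct {a b c d e f m₀ m₁ m₂ m₃ : ℕ} (h₀ : m₀ ≤ d + e + f)
    (h₁ : m₁ ≤ b + c + e) (h₂ : m₂ ≤ a + c + f) (h₃ : m₃ ≤ a + b + d) :
    HasOrders m₀ m₁ m₂ m₃ (diffProduct K a b c d e f) := by
  have hpt (i j : Fin 3) : (Polynomial.X : Polynomial (MvPolynomial (Fin 3) K)) ^ 1 ∣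
      ((pointHom (1 : Fin 3 → K)).comp (expand 2)).toRingHom (X i - X j) := by
    change _ ∣ pointHom (1 : Fin 3 → K) (expand 2 (X i - X j))
    rw [map_sub, map_sub, pointHom_one_expand_X, pointHom_one_expand_X, sq_sub_sq, pow_one]
    exact Dvd.dvd.mul_left ⟨Polynomial.C (![X 0, X 1, 0] i) - Polynomial.C (![X 0, X 1, 0] j),
      by ring⟩ _
  have hw (k i : Fin 3) : (Polynomial.X : Polynomial (MvPolynomial (Fin 3) K)) ^ coordWeight k i ∣
      (weightHom K (coordWeight k)).toRingHom (X i) := by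
    change _ ∣ weightHom K (coordWeight k) (X i)
    rw [weightHom_coordWeight_X]
    exact dvd_mul_left _ _
  have hw' (k i j : Fin 3) : (Polynomial.X : Polynomial (MvPolynomial (Fin 3) K)) ^
      min (coordWeight k i) (coordWeight k j) ∣
      (weightHom K (coordWeight k)).toRingHom (X i - X j) := by
    rw [map_sub]
    exact dvd_sub ((pow_dvd_pow _ (min_le_left _ _)).trans (hw k i))
      ((pow_dvd_pow _ (min_le_right _ _)).trans (hw k j))
  have h1 (π g : Polynomial (MvPolynomial (Fin 3) K)) : π ^ 0 ∣ g := by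
    rw [pow_zero]; exact one_dvd _
  refine ⟨?_, ?_, ?_, ?_⟩
  · exact pow_dvd_map_diffProduct ((pointHom (1 : Fin 3 → K)).comp (expand 2)).toRingHom
      (h1 _ _) (h1 _ _) (h1 _ _) (hpt 0 1) (hpt 1 2) (hpt 2 0) (by omega)
  · exact pow_dvd_map_diffProduct (weightHom K (coordWeight 0)).toRingHom (hw 0 0) (hw 0 1)
      (hw 0 2) (hw' 0 0 1) (hw' 0 1 2) (hw' 0 2 0) (by simp [coordWeight]; omega)
  · exact pow_dvd_map_diffProduct (weightHom K (coordWeight 1)).toRingHom (hw 1 0) (hw 1 1)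
      (hw 1 2) (hw' 1 0 1) (hw' 1 1 2) (hw' 1 2 0) (by simp [coordWeight]; omega)
  · exact pow_dvd_map_diffProduct (weightHom K (coordWeight 2)).toRingHom (hw 2 0) (hw 2 1)
      (hw 2 2) (hw' 2 0 1) (hw' 2 1 2) (hw' 2 2 0) (by simp [coordWeight]; omega)

theorem hasOrders_of_mem_span_diffProducts {t m₀ m₁ m₂ m₃ : ℕ} {q : MvPolynomial (Fin 3) K}
    (hq : q ∈ Submodule.span K (diffProducts K t m₀ m₁ m₂ m₃)) : HasOrders m₀ m₁ m₂ m₃ q := by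
  induction hq using Submodule.span_induction with
  | mem q hq =>
    obtain ⟨a, b, c, d, e, f, -, h₀, h₁, h₂, h₃, rfl⟩ := hq
    exact hasOrders_diffProduct h₀ h₁ h₂ h₃
  | zero => constructor <;> simp
  | add p q _ _ hp hq => exact hp.add hq
  | smul c p _ hp => exact hp.smul c

theorem not_X_dvd_of_coeff {A : Type*} [CommRing A] {u : Polynomial A} (h : u.coeff 0 ≠ 0) :
    ¬ Polynomial.X ∣ u := fun h' => h (Polynomial.X_dvd_iff.mp h')

theorem X_sub_X_ne_zero {i j : Fin 3} (h : i ≠ j) : (X i - X j : MvPolynomial (Fin 3) K) ≠ 0 :=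
  sub_ne_zero.mpr fun h' => h (X_injective h')

/-- The line w = 0 passes simply through (1,0,0) and (0,1,0) and misses the other two points. -/
theorem HasOrders.of_mul_X {m₀ m₁ m₂ m₃ : ℕ} {q : MvPolynomial (Fin 3) K}
    (h : HasOrders m₀ m₁ m₂ m₃ (X 2 * q)) : HasOrders m₀ (m₁ - 1) (m₂ - 1) m₃ q := by
  obtain ⟨h₀, h₁, h₂, h₃⟩ := h
  have hX : ¬ (Polynomial.X : Polynomial (MvPolynomial (Fin 3) K)) ∣ Polynomial.C (X 2) :=
    not_X_dvd_of_coeff (by simp)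
  have hX2 : ¬ (Polynomial.X : Polynomial (MvPolynomial (Fin 3) K)) ∣ Polynomial.C (X 2) ^ 2 :=
    not_X_dvd_of_coeff (by simp [Polynomial.coeff_zero_eq_eval_zero])
  rw [map_mul, map_mul, pointHom_one_expand_X] at h₀
  rw [map_mul, weightHom_coordWeight_X] at h₁ h₂ h₃
  refine ⟨pow_sub_dvd_of_dvd_mul (k := 0) (by simpa using h₀) hX2,
    pow_sub_dvd_of_dvd_mul (k := 1)
      (by rw [mul_comm (_ ^ 1)]; simpa [coordWeight] using h₁) hX,
    pow_sub_dvd_of_dvd_mul (k := 1)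
      (by rw [mul_comm (_ ^ 1)]; simpa [coordWeight] using h₂) hX,
    pow_sub_dvd_of_dvd_mul (k := 0) (by simpa [coordWeight] using h₃) hX⟩

/-- The line u = v contains only (1,1,1) and (0,0,1). At (1,1,1), squaring the variables keeps the
order equal to one because 2 ≠ 0. -/
theorem HasOrders.of_mul_sub [CharZero K] {m₀ m₁ m₂ m₃ : ℕ} {q : MvPolynomial (Fin 3) K}
    (h : HasOrders m₀ m₁ m₂ m₃ ((X 0 - X 1) * q)) : HasOrders (m₀ - 1) m₁ m₂ (m₃ - 1) q := by
  obtain ⟨h₀, h₁, h₂, h₃⟩ := h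
  have hne : (X 0 - X 1 : MvPolynomial (Fin 3) K) ≠ 0 := X_sub_X_ne_zero (by decide)
  rw [map_mul, map_mul, map_sub, map_sub, pointHom_one_expand_X, pointHom_one_expand_X] at h₀
  rw [map_mul, map_sub, weightHom_coordWeight_X, weightHom_coordWeight_X] at h₁ h₂ h₃
  refine ⟨pow_sub_dvd_of_dvd_mul (k := 1) (u := Polynomial.C (X 0 - X 1) *
      (2 * Polynomial.C (X 2) + Polynomial.X * Polynomial.C (X 0 + X 1))) ?_
      (not_X_dvd_of_coeff ?_),
    pow_sub_dvd_of_dvd_mul (k := 0)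
      (u := Polynomial.C (X 0) - Polynomial.C (X 1) * Polynomial.X)
      (by simpa [coordWeight] using h₁) (not_X_dvd_of_coeff (by simp)),
    pow_sub_dvd_of_dvd_mul (k := 0)
      (u := Polynomial.C (X 0) * Polynomial.X - Polynomial.C (X 1))
      (by simpa [coordWeight] using h₂) (not_X_dvd_of_coeff (by simp)),
    pow_sub_dvd_of_dvd_mul (k := 1) (u := Polynomial.C (X 0 - X 1)) ?_
      (not_X_dvd_of_coeff (by simpa using hne))⟩
  · convert h₀ using 2
    simp only [map_sub, map_add, Matrix.cons_val_zero, Matrix.cons_val_one]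
    ring
  · simp [Polynomial.coeff_zero_eq_eval_zero, hne]
  · convert h₃ using 2
    simp [coordWeight]
    ring

end FatPoints

/-! ### Spanning the ideal of four fat points by products of lines. -/

section FatPointIdeals

open MvPolynomial

variable {K : Type*} [Field K]

/-- The restriction to the line `u = v`. -/
noncomputable def restrictLine (K : Type*) [Field K] :
    MvPolynomial (Fin 3) K →ₐ[K] MvPolynomial (Fin 3) K :=
  aeval ![X 0, X 0, X 2]

theorem restrictLine_X_zero : restrictLine K (X 0) = X 0 := by simp [restrictLine]

theorem restrictLine_X_one : restrictLine K (X 1) = X 0 := by simp [restrictLine]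

theorem restrictLine_X_two : restrictLine K (X 2) = X 2 := by simp [restrictLine]

theorem restrictLine_restrictLine (q : MvPolynomial (Fin 3) K) :
    restrictLine K (restrictLine K q) = restrictLine K q := by
  have : (restrictLine K).comp (restrictLine K) = restrictLine K := by
    ext1 i
    fin_cases i <;> simp [restrictLine]
  exact DFunLike.congr_fun this q

theorem sub_dvd_of_restrictLine_eq_zero {q : MvPolynomial (Fin 3) K} (h : restrictLine K q = 0) :
    X 0 - X 1 ∣ q := by
  have h' : (aeval ![X 0, X 0, X 2] : _ →ₐ[K] MvPolynomial (Fin 3) K) q = 0 := h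
  have h1 := aeval_sub_aeval_mem (K := K) (Ideal.span {(X 0 - X 1 : MvPolynomial (Fin 3) K)})
    (s := X) (t := ![X 0, X 0, X 2]) ?_ q
  · rw [aeval_X_left_apply, h', sub_zero] at h1
    exact Ideal.mem_span_singleton.mp h1
  · intro i
    rw [Ideal.mem_span_singleton]
    fin_cases i
    · simp
    · exact ⟨-1, by simp⟩
    · simp

theorem X_pow_dvd_restrictLine {m : ℕ} {q : MvPolynomial (Fin 3) K}
    (h : Polynomial.X ^ m ∣ weightHom K (coordWeight 2) q) : X 0 ^ m ∣ restrictLine K q := by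
  let φ : Polynomial (MvPolynomial (Fin 3) K) →+* MvPolynomial (Fin 3) K :=
    Polynomial.eval₂RingHom
      (aeval ![1, 1, X 2] : _ →ₐ[K] MvPolynomial (Fin 3) K).toRingHom (X 0)
  have hφ : φ.comp (weightHom K (coordWeight 2)).toRingHom = (restrictLine K).toRingHom := by
    apply MvPolynomial.ringHom_ext
    · intro a
      simp [φ, weightHom, restrictLine, Polynomial.algebraMap_apply]
    · intro i
      fin_cases i <;> simp [φ, weightHom, restrictLine, coordWeight]
  have h1 := map_dvd φ h
  rw [map_pow] at h1
  have h2 : φ (weightHom K (coordWeight 2) q) = restrictLine K q := DFunLike.congr_fun hφ q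
  rwa [h2, show φ Polynomial.X = X 0 by simp [φ]] at h1

/-- The substitution `u, v ↦ (z + T)²`, `w ↦ z²`. -/
noncomputable def diagonalHom (K : Type*) [Field K] :
    MvPolynomial (Fin 3) K →ₐ[K] Polynomial (MvPolynomial (Fin 3) K) :=
  aeval ![(Polynomial.C (X 2) + Polynomial.X) ^ 2, (Polynomial.C (X 2) + Polynomial.X) ^ 2,
    Polynomial.C (X 2) ^ 2]

theorem pow_dvd_diagonalHom_restrictLine {m : ℕ} {q : MvPolynomial (Fin 3) K}
    (h : Polynomial.X ^ m ∣ pointHom (1 : Fin 3 → K) (expand 2 q)) :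
    Polynomial.X ^ m ∣ diagonalHom K (restrictLine K q) := by
  let φ : Polynomial (MvPolynomial (Fin 3) K) →+* Polynomial (MvPolynomial (Fin 3) K) :=
    Polynomial.mapRingHom (aeval ![1, 1, X 2] : _ →ₐ[K] MvPolynomial (Fin 3) K).toRingHom
  have hφ : φ.comp ((pointHom (1 : Fin 3 → K)).comp (expand 2)).toRingHom =
      ((diagonalHom K).comp (restrictLine K)).toRingHom := by
    apply MvPolynomial.ringHom_ext
    · intro a
      simp [φ, pointHom, restrictLine, diagonalHom, Polynomial.algebraMap_apply]
    · intro i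
      fin_cases i <;> simp [φ, pointHom, restrictLine, diagonalHom]
  have h1 := map_dvd φ h
  have h2 : φ (pointHom (1 : Fin 3 → K) (expand 2 q)) = diagonalHom K (restrictLine K q) :=
    DFunLike.congr_fun hφ q
  rwa [h2, map_pow, show φ Polynomial.X = Polynomial.X by simp [φ]] at h1

/-- The substitution sends u - w to T(2z + T), where T does not divide the second factor; so factors
u - w can be removed one at a time. -/
theorem sub_pow_dvd_of_diagonalHom [CharZero K] {m : ℕ} {r : MvPolynomial (Fin 3) K}
    (hr : restrictLine K r = r) (h : Polynomial.X ^ m ∣ diagonalHom K r) :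
    (X 0 - X 2) ^ m ∣ r := by
  induction m generalizing r with
  | zero => rw [pow_zero]; exact one_dvd _
  | succ m ih =>
    have h0 : aeval (fun _ => X 2 : Fin 3 → MvPolynomial (Fin 3) K) r = 0 := by
      have h1 := Polynomial.X_dvd_iff.mp ((dvd_pow_self Polynomial.X m.succ_ne_zero).trans h)
      rw [diagonalHom, coeff_zero_aeval] at h1
      rw [← expand_eq_zero (p := 2) (by norm_num), ← h1, ← AlgHom.comp_apply]
      congr 1
      ext1 i
      fin_cases i <;> simp [Polynomial.coeff_zero_eq_eval_zero]
    have h1 := aeval_sub_aeval_mem (K := K) (Ideal.span {(X 0 - X 2 : MvPolynomial (Fin 3) K)})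
      (s := ![X 0, X 0, X 2]) (t := fun _ => X 2) ?_ r
    · rw [h0, sub_zero, show aeval ![X 0, X 0, X 2] r = r from hr, Ideal.mem_span_singleton] at h1
      obtain ⟨r₁, hr₁⟩ := h1
      have hr₂ : r = (X 0 - X 2) * restrictLine K r₁ := by
        rw [← hr, hr₁, map_mul, map_sub, restrictLine_X_zero, restrictLine_X_two]
      rw [hr₂, pow_succ']
      refine mul_dvd_mul_left _ (ih (restrictLine_restrictLine _) ?_)
      rw [hr₂, map_mul] at h
      refine pow_sub_dvd_of_dvd_mul (m := m + 1) (k := 1)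
        (u := 2 * Polynomial.C (X 2) + Polynomial.X) ?_ (not_X_dvd_of_coeff ?_)
      · convert h using 2
        simp [diagonalHom]
        ring
      · simp [Polynomial.coeff_zero_eq_eval_zero]
    · intro i
      rw [Ideal.mem_span_singleton]
      fin_cases i <;> simp

theorem exists_eq_mul_of_isHomogeneous {q h : MvPolynomial (Fin 3) K} {t k : ℕ}
    (hq : q.IsHomogeneous t) (hh : h.IsHomogeneous k) (hdvd : h ∣ q) :
    q = 0 ∨ ∃ t' s, t = t' + k ∧ s.IsHomogeneous t' ∧ q = h * s := by
  obtain ⟨s, rfl⟩ := hdvd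
  have h1 := homogeneousComponent_mul_of_isHomogeneous hh s t
  rw [mul_comm s h, homogeneousComponent_eq_self hq] at h1
  split_ifs at h1 with hk
  · exact Or.inr ⟨t - k, homogeneousComponent (t - k) s, by omega,
      homogeneousComponent_isHomogeneous _ _, by rw [h1, mul_comm]⟩
  · exact Or.inl h1

theorem exists_diffProduct_restrictLine {t m₀ m₁ m₂ m₃ α c : ℕ} (ht : α + c + m₀ = t)
    (h3 : m₃ ≤ α) (h12 : m₁ + m₂ ≤ t) :
    ∃ μ ∈ Submodule.span K (diffProducts K t m₀ m₁ m₂ m₃),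
      restrictLine K μ = X 0 ^ α * X 2 ^ c * (X 0 - X 2) ^ m₀ := by
  obtain ⟨a, b, e, f, rfl, rfl, h1, h2⟩ : ∃ a b e f : ℕ, a + b = α ∧ e + f = m₀ ∧
      m₁ ≤ b + c + e ∧ m₂ ≤ a + c + f := by
    -- What `c` leaves missing at (1,0,0) is covered by `b` first and then by `e`; everything else
    -- goes to (0,1,0), which suffices because m₁ + m₂ ≤ t.
    obtain ⟨y, hy⟩ : ∃ y, y = m₁ - c := ⟨_, rfl⟩
    obtain ⟨b, hb⟩ : ∃ b, b = min y α := ⟨_, rfl⟩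
    exact ⟨α - b, b, y - b, m₀ - (y - b), by omega, by omega, by omega, by omega⟩
  refine ⟨(-1 : K) ^ f • diffProduct K a b c 0 e f, Submodule.smul_mem _ _
    (Submodule.subset_span ⟨a, b, c, 0, e, f, by omega, by omega, h1, h2, by omega, rfl⟩), ?_⟩
  rw [map_smul, diffProduct]
  simp only [map_mul, map_pow, map_sub, restrictLine_X_zero, restrictLine_X_one,
    restrictLine_X_two, pow_zero, map_one]
  rw [← neg_sub (X 0 : MvPolynomial (Fin 3) K) (X 2), neg_pow (X 0 - X 2) f, smul_eq_C_mul, C_pow,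
    C_neg, C_1]
  have : ((-1) ^ f * (-1) ^ f : MvPolynomial (Fin 3) K) = 1 := by
    rw [← mul_pow]; simp
  linear_combination (X 0 ^ (a + b) * X 2 ^ c * (X 0 - X 2) ^ (e + f)) * this

theorem sum_eq_of_mem_support {s : MvPolynomial (Fin 3) K} {t : ℕ} (hs : s.IsHomogeneous t)
    {n : Fin 3 →₀ ℕ} (hn : n ∈ s.support) : n 0 + n 1 + n 2 = t := by
  have h : n.degree = t := by
    by_contra hne
    exact (mem_support_iff.mp hn) (hs.coeff_eq_zero hne)
  rwa [Finsupp.degree_eq_sum, Fin.sum_univ_three] at h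

/-- On the line u = v the orders at (1,1,1) and (0,0,1) force the factor (u-w)^m₀ u^m₃. Each
monomial of the cofactor then yields a form that lifts to a product of lines. -/
theorem restrictLine_mem_map_span [CharZero K] {t m₀ m₁ m₂ m₃ : ℕ} {q : MvPolynomial (Fin 3) K}
    (hq : q.IsHomogeneous t) (h : HasOrders m₀ m₁ m₂ m₃ q) (h12 : m₁ + m₂ ≤ t) :
    restrictLine K q ∈ (Submodule.span K (diffProducts K t m₀ m₁ m₂ m₃)).map
      (restrictLine K).toLinearMap := by
  set r := restrictLine K q with hr
  have hrr : restrictLine K r = r := restrictLine_restrictLine q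
  have hrt : r.IsHomogeneous t := by
    have := hq.aeval (n := 1) ![X 0, X 0, X 2] (S := K) (τ := Fin 3) (by
      intro i; fin_cases i <;> exact isHomogeneous_X _ _)
    rwa [one_mul] at this
  obtain ⟨s₁, hs₁⟩ := sub_pow_dvd_of_diagonalHom hrr (pow_dvd_diagonalHom_restrictLine h.one)
  have hdvd : X 0 ^ m₃ ∣ s₁ := by
    have h3 := X_pow_dvd_restrictLine h.trd
    rw [← hr, hs₁] at h3
    refine (X_prime (i := (0 : Fin 3))).pow_dvd_of_dvd_mul_left _ (fun hd => ?_) h3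
    have h4 := map_dvd (aeval ![0, X 1, X 2] : _ →ₐ[K] MvPolynomial (Fin 3) K)
      ((X_prime (i := (0 : Fin 3))).dvd_of_dvd_pow hd)
    simp at h4
  have hhom : ((X 0 - X 2) ^ m₀ * X 0 ^ m₃ : MvPolynomial (Fin 3) K).IsHomogeneous (m₀ + m₃) := by
    refine IsHomogeneous.mul ?_ (isHomogeneous_X_pow 0 m₃)
    simpa using ((isHomogeneous_X K 0).sub (isHomogeneous_X K 2)).pow m₀
  rcases exists_eq_mul_of_isHomogeneous hrt hhom (hs₁ ▸ mul_dvd_mul_left _ hdvd) with h0 | h0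
  · rw [h0]; exact zero_mem _
  · obtain ⟨t', s, rfl, hs, hrs⟩ := h0
    have hsum : r = ∑ n ∈ s.support, coeff n s •
        (X 0 ^ (m₃ + n 0 + n 1) * X 2 ^ n 2 * (X 0 - X 2) ^ m₀) := by
      rw [← hrr, hrs, map_mul]
      nth_rewrite 1 [s.as_sum]
      rw [map_sum, Finset.mul_sum]
      refine Finset.sum_congr rfl fun n _ => ?_
      have h1 : restrictLine K (monomial n (coeff n s)) =
          C (coeff n s) * (X 0 ^ n 0 * X 0 ^ n 1 * X 2 ^ n 2) := by
        rw [restrictLine, aeval_monomial, Finsupp.prod_fintype _ _ (by simp), Fin.prod_univ_three]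
        simp
      rw [h1, smul_eq_C_mul]
      simp only [map_mul, map_pow, map_sub, restrictLine_X_zero, restrictLine_X_two]
      ring
    rw [hsum]
    refine sum_mem fun n hn => Submodule.smul_mem _ _ ?_
    have hdeg := sum_eq_of_mem_support hs hn
    obtain ⟨μ, hμ, hμ'⟩ := exists_diffProduct_restrictLine (K := K) (t := t' + (m₀ + m₃))
      (m₀ := m₀) (m₁ := m₁) (m₂ := m₂) (m₃ := m₃) (α := m₃ + n 0 + n 1) (c := n 2)
      (by omega) (by omega) h12
    exact ⟨μ, hμ, hμ'⟩

theorem mul_mem_span_of_forall {S S' : Set (MvPolynomial (Fin 3) K)} {h q : MvPolynomial (Fin 3) K}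
    (hS : ∀ g ∈ S, h * g ∈ S') (hq : q ∈ Submodule.span K S) :
    h * q ∈ Submodule.span K S' := by
  have : Submodule.span K S ≤ (Submodule.span K S').comap (LinearMap.mulLeft K h) := by
    rw [Submodule.span_le]
    exact fun g hg => Submodule.subset_span (hS g hg)
  exact this hq

/-- The ideal of four fat points in general position in the plane is spanned by products of the
six lines through pairs of these points. -/
theorem mem_span_diffProducts [CharZero K] (t : ℕ) :
    ∀ {m₀ m₁ m₂ m₃ : ℕ} {q : MvPolynomial (Fin 3) K}, q.IsHomogeneous t →
      HasOrders m₀ m₁ m₂ m₃ q → q ∈ Submodule.span K (diffProducts K t m₀ m₁ m₂ m₃) := by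
  induction t using Nat.strong_induction_on with
  | h t ih => ?_
  intro m₀ m₁ m₂ m₃ q hq h
  -- If the inequality holds, subtracting a lift of the restriction to u = v leaves a multiple of u
  -- - v. Otherwise Bézout on the line w = 0 makes `q` divisible by w. Both cases lower the degree.
  by_cases h12 : m₁ + m₂ ≤ t
  · obtain ⟨ν, hν, hνq⟩ := restrictLine_mem_map_span hq h h12
    have hr : restrictLine K (q - ν) = 0 := by
      rw [map_sub, sub_eq_zero]; exact hνq.symm
    have hν' := neg_mem hν
    have hord : HasOrders m₀ m₁ m₂ m₃ (q - ν) := by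
      rw [sub_eq_add_neg]; exact h.add (hasOrders_of_mem_span_diffProducts hν')
    suffices hsub : q - ν ∈ Submodule.span K (diffProducts K t m₀ m₁ m₂ m₃) by
      simpa using add_mem hsub hν
    rcases exists_eq_mul_of_isHomogeneous (hq.sub (isHomogeneous_of_mem_span_diffProducts hν))
      ((isHomogeneous_X K 0).sub (isHomogeneous_X K 1)) (sub_dvd_of_restrictLine_eq_zero hr)
      with h0 | ⟨t', s, rfl, hs, hqs⟩
    · rw [h0]; exact zero_mem _
    · rw [hqs] at hord ⊢
      refine mul_mem_span_of_forall ?_ (ih t' (by omega) hs hord.of_mul_sub)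
      rintro _ ⟨a, b, c, d, e, f, h1, h2, h3, h4, h5, rfl⟩
      refine ⟨a, b, c, d + 1, e, f, by omega, by omega, by omega, by omega, by omega, ?_⟩
      unfold diffProduct; ring
  · have hdvd : X 2 ∣ q := by
      rw [q.as_sum]
      refine Finset.dvd_sum fun n hn => ?_
      rw [X_dvd_monomial]
      right
      have h1 := (pow_dvd_weightHom_iff _).mp h.fst n hn
      have h2 := (pow_dvd_weightHom_iff _).mp h.snd n hn
      have h3 := sum_eq_of_mem_support hq hn
      simp [Fin.sum_univ_three, coordWeight] at h1 h2
      omega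
    rcases exists_eq_mul_of_isHomogeneous hq (isHomogeneous_X K 2) hdvd
      with h0 | ⟨t', s, rfl, hs, rfl⟩
    · rw [h0]; exact zero_mem _
    · refine mul_mem_span_of_forall ?_ (ih t' (by omega) hs h.of_mul_X)
      rintro _ ⟨a, b, c, d, e, f, h1, h2, h3, h4, h5, rfl⟩
      refine ⟨a, b, c + 1, d, e, f, by omega, by omega, by omega, by omega, by omega, ?_⟩
      unfold diffProduct; ring

end FatPointIdeals

/-! ### Splitting into degree and parity components. -/

section Components

open MvPolynomial

/-- Applying f - μ a to the sum removes the summand `a` and multiplies the others by nonzero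
scalars. -/
theorem Submodule.mem_of_sum_mem_of_eigenvectors {K M ι : Type*} [Field K] [AddCommGroup M]
    [Module K M] [DecidableEq ι] {V : Submodule K M} {f : M →ₗ[K] M} (hf : ∀ v ∈ V, f v ∈ V)
    (μ : ι → K) (s : Finset ι) (hμ : Set.InjOn μ s) (v : ι → M)
    (hv : ∀ i ∈ s, f (v i) = μ i • v i) (hs : ∑ i ∈ s, v i ∈ V) : ∀ i ∈ s, v i ∈ V := by
  induction s using Finset.induction_on generalizing v with
  | empty => simp
  | insert a s ha ih =>
    have hμ' : Set.InjOn μ s := hμ.mono (by simp)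
    have h1 : ∑ i ∈ s, (μ i - μ a) • v i ∈ V := by
      have h2 := sub_mem (hf _ hs) (V.smul_mem (μ a) hs)
      rw [map_sum, Finset.smul_sum, ← Finset.sum_sub_distrib, Finset.sum_insert ha,
        hv a (Finset.mem_insert_self a s), sub_self, zero_add] at h2
      convert h2 using 1
      refine Finset.sum_congr rfl fun i hi => ?_
      rw [hv i (Finset.mem_insert_of_mem hi), sub_smul]
    have h3 : ∀ i ∈ s, v i ∈ V := by
      intro i hi
      have h4 := ih hμ' (fun i => (μ i - μ a) • v i) (by
        intro j hj
        rw [map_smul, hv j (Finset.mem_insert_of_mem hj), smul_comm]) h1 i hi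
      refine (V.smul_mem_iff (sub_ne_zero.mpr fun h => ?_)).mp h4
      have := hμ (by simp [hi]) (by simp) h
      exact ha (this ▸ hi)
    intro i hi
    rcases Finset.mem_insert.mp hi with rfl | hi
    · rw [Finset.sum_insert ha] at hs
      exact (V.add_mem_iff_left (sum_mem h3)).mp hs
    · exact h3 i hi

variable {K : Type*} [Field K]

/-- The polynomials that have order at least `m` at `(c 0, c 1, c 2)` for all `c` with nonzero
coordinates whose squares are equal. -/
def ordersSubmodule (K : Type*) [Field K] (m : ℕ) : Submodule K (MvPolynomial (Fin 3) K) where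
  carrier := {p | ∀ c : Fin 3 → K, (∀ i, c i ≠ 0) → (∀ i j, c i ^ 2 = c j ^ 2) →
    Polynomial.X ^ m ∣ pointHom c p}
  add_mem' hp hq c hc hcc := by rw [map_add]; exact dvd_add (hp c hc hcc) (hq c hc hcc)
  zero_mem' c hc hcc := by simp
  smul_mem' a p hp c hc hcc := by rw [map_smul]; exact dvd_smul_of_dvd a (hp c hc hcc)

/-- The substitution `X i ↦ c i * X i`. -/
noncomputable def scaleHom (c : Fin 3 → K) : MvPolynomial (Fin 3) K →ₐ[K] MvPolynomial (Fin 3) K :=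
  aeval fun i => C (c i) * X i

theorem scaleHom_monomial (c : Fin 3 → K) (n : Fin 3 →₀ ℕ) (a : K) :
    scaleHom c (monomial n a) = (∏ i, c i ^ n i) • monomial n a := by
  rw [scaleHom, aeval_monomial, Finsupp.prod_fintype _ _ (by simp), monomial_eq,
    Finsupp.prod_fintype _ _ (by simp), smul_eq_C_mul]
  simp only [mul_pow, Finset.prod_mul_distrib, map_prod, map_pow, algebraMap_eq]
  ring

/-- Such a scaling permutes the representatives of the four sign points. -/
theorem scaleHom_mem_ordersSubmodule {c : Fin 3 → K} (hc : ∀ i, c i ≠ 0)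
    (hcc : ∀ i j, c i ^ 2 = c j ^ 2) {m : ℕ} {p : MvPolynomial (Fin 3) K}
    (hp : p ∈ ordersSubmodule K m) : scaleHom c p ∈ ordersSubmodule K m := by
  intro c' hc' hcc'
  have h := hp (c * c') (fun i => mul_ne_zero (hc i) (hc' i)) (fun i j => by
    simp only [Pi.mul_apply, mul_pow, hcc i j, hcc' i j])
  have h1 : (pointHom c').comp (scaleHom c) = pointHom (c * c') := by
    ext1 i
    simp [pointHom, scaleHom, Polynomial.algebraMap_apply, mul_assoc]
  rwa [← h1] at h

/-- A polynomial with prescribed orders is the sum of such polynomials on whose support a given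
class function is constant, if the classes are the eigenspaces of a suitable scaling. -/
theorem mem_of_forall_component_mem {c : Fin 3 → K} (hc : ∀ i, c i ≠ 0)
    (hcc : ∀ i j, c i ^ 2 = c j ^ 2) {m : ℕ} {p : MvPolynomial (Fin 3) K}
    (hp : p ∈ ordersSubmodule K m) (κ : (Fin 3 →₀ ℕ) → ℕ) (μ : ℕ → K)
    (hμ : ∀ n n', μ (κ n) = μ (κ n') → κ n = κ n') (hμκ : ∀ n, ∏ i, c i ^ n i = μ (κ n))
    {J : Ideal (MvPolynomial (Fin 3) K)}
    (h : ∀ p' ∈ ordersSubmodule K m, p'.support ⊆ p.support →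
      (∃ k, ∀ n ∈ p'.support, κ n = k) → p' ∈ J) : p ∈ J := by
  classical
  have hsum : p = ∑ k ∈ p.support.image κ, ∑ n ∈ p.support with κ n = k, monomial n (coeff n p) := by
    rw [Finset.sum_fiberwise_of_maps_to fun n hn => Finset.mem_image_of_mem κ hn]
    exact p.as_sum
  have hcoeff (k : ℕ) (d : Fin 3 →₀ ℕ) :
      coeff d (∑ n ∈ p.support with κ n = k, monomial n (coeff n p)) ≠ 0 →
        d ∈ p.support ∧ κ d = k := by
    intro hd
    rw [coeff_sum] at hd
    obtain ⟨n, hn, hnd⟩ := Finset.exists_ne_zero_of_sum_ne_zero hd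
    rw [coeff_monomial] at hnd
    obtain rfl : n = d := by
      by_contra hne
      exact hnd (if_neg hne)
    exact Finset.mem_filter.mp hn
  rw [hsum]
  refine sum_mem fun k hk => h _ ?_ (fun d hd => (hcoeff k d (mem_support_iff.mp hd)).1)
    ⟨k, fun d hd => (hcoeff k d (mem_support_iff.mp hd)).2⟩
  refine Submodule.mem_of_sum_mem_of_eigenvectors (f := (scaleHom c).toLinearMap)
    (fun v hv => scaleHom_mem_ordersSubmodule hc hcc hv) μ (p.support.image κ) ?_
    (fun k => ∑ n ∈ p.support with κ n = k, monomial n (coeff n p)) ?_ (hsum ▸ hp) k hk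
  · intro x hx y hy hxy
    obtain ⟨n, -, rfl⟩ := Finset.mem_image.mp (Finset.mem_coe.mp hx)
    obtain ⟨n', -, rfl⟩ := Finset.mem_image.mp (Finset.mem_coe.mp hy)
    exact hμ n n' hxy
  · intro k _
    rw [map_sum, Finset.smul_sum]
    refine Finset.sum_congr rfl fun n hn => ?_
    rw [AlgHom.toLinearMap_apply, scaleHom_monomial, hμκ, (Finset.mem_filter.mp hn).2]

theorem mem_of_forall_parity_component_mem [CharZero K] (i : Fin 3) {m : ℕ}
    {p : MvPolynomial (Fin 3) K} (hp : p ∈ ordersSubmodule K m)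
    {J : Ideal (MvPolynomial (Fin 3) K)}
    (h : ∀ p' ∈ ordersSubmodule K m, p'.support ⊆ p.support →
      (∃ k, ∀ n ∈ p'.support, n i % 2 = k) → p' ∈ J) : p ∈ J := by
  refine mem_of_forall_component_mem (c := fun j => if j = i then -1 else 1) ?_ ?_ hp
    (fun n => n i % 2) (fun k => (-1) ^ k) ?_ ?_ h
  · intro j; split_ifs <;> simp
  · intro j k; split_ifs <;> simp
  · intro n n' hn
    rcases Nat.mod_two_eq_zero_or_one (n i) with h1 | h1 <;>
      rcases Nat.mod_two_eq_zero_or_one (n' i) with h2 | h2 <;>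
      simp only [h1, h2] at hn ⊢ <;> norm_num at hn
  · intro n
    simp only [ite_pow, one_pow, Finset.prod_ite_eq', Finset.mem_univ, if_true]
    exact neg_one_pow_eq_pow_mod_two (n i)

theorem mem_of_forall_degree_component_mem [CharZero K] {m : ℕ}
    {p : MvPolynomial (Fin 3) K} (hp : p ∈ ordersSubmodule K m)
    {J : Ideal (MvPolynomial (Fin 3) K)}
    (h : ∀ p' ∈ ordersSubmodule K m, p'.support ⊆ p.support →
      (∃ k, ∀ n ∈ p'.support, n 0 + n 1 + n 2 = k) → p' ∈ J) : p ∈ J := by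
  refine mem_of_forall_component_mem (c := fun _ => 2) (by simp) (by simp) hp
    (fun n => n 0 + n 1 + n 2) (fun k => 2 ^ k) ?_ ?_ h
  · intro n n' hn
    have : ((2 ^ (n 0 + n 1 + n 2) : ℕ) : K) = ((2 ^ (n' 0 + n' 1 + n' 2) : ℕ) : K) := by
      push_cast; exact hn
    exact Nat.pow_right_injective le_rfl (Nat.cast_injective this)
  · intro n
    rw [Fin.prod_univ_three, pow_add, pow_add]

end Components

/-! ### The containment and its numerical instances. -/

section Containment

open MvPolynomial

variable {K : Type*} [Field K]

theorem isHomogeneous_lineProduct (A B C' d e f : ℕ) :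
    (lineProduct (X 0) (X 1) (X 2) A B C' d e f : MvPolynomial (Fin 3) K).IsHomogeneous
      (A + B + C' + 2 * d + 2 * e + 2 * f) := by
  have h (i : Fin 3) (n : ℕ) : (X i ^ n : MvPolynomial (Fin 3) K).IsHomogeneous n :=
    isHomogeneous_X_pow i n
  have h' (i j : Fin 3) (n : ℕ) :
      ((X i ^ 2 - X j ^ 2) ^ n : MvPolynomial (Fin 3) K).IsHomogeneous (2 * n) :=
    ((h i 2).sub (h j 2)).pow n
  exact (((((h 0 A).mul (h 1 B)).mul (h 2 C')).mul (h' 0 1 d)).mul (h' 1 2 e)).mul (h' 2 0 f)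

/-- Adding `h1`, `h2`, `h3` and twice `h0` shows that twice the degree is at least 5m. The +1 in
`hl` is free because twice the degree is even. -/
theorem lineProduct_mem_pow_mul_pow {A B C' d e f m l r : ℕ} (h1 : m ≤ B + C' + 2 * e)
    (h2 : m ≤ A + C' + 2 * f) (h3 : m ≤ A + B + 2 * d) (h0 : m ≤ d + e + f) (hr : 1 ≤ r)
    (hm : 2 * r ≤ m + 2) (hmr : 2 * r ≤ m + 1 ∨ 3 ≤ r) (hl : 2 * (l + 3 * r) ≤ 5 * m + 1) :
    (lineProduct (X 0) (X 1) (X 2) A B C' d e f : MvPolynomial (Fin 3) K) ∈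
      idealOfVars (Fin 3) K ^ l * fermatIdeal K 2 ^ r := by
  refine mem_pow_idealOfVars_mul_span_pow (k := 3) ?_
    (lineProduct_mem_pow (I := fermatIdeal K 2) (Ideal.subset_span (by simp))
      (Ideal.subset_span (by simp)) (Ideal.subset_span (by simp)) h1 h2 h3 h0 hr hm hmr)
    (isHomogeneous_lineProduct A B C' d e f) (by omega)
  have h (i j k : Fin 3) :
      (X i * (X j ^ 2 - X k ^ 2) : MvPolynomial (Fin 3) K).IsHomogeneous 3 :=
    (isHomogeneous_X K i).mul ((isHomogeneous_X_pow j 2).sub (isHomogeneous_X_pow k 2))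
  rintro g (rfl | rfl | rfl)
  exacts [h 0 1 2, h 1 2 0, h 2 0 1]

theorem mem_of_homogeneous_of_parity [CharZero K] {m l r t ε₀ ε₁ ε₂ : ℕ}
    {p : MvPolynomial (Fin 3) K}
    (hp : Polynomial.X ^ m ∣ pointHom 1 p)
    (hw : ∀ k : Fin 3, Polynomial.X ^ m ∣ weightHom K (coordWeight k) p)
    (ht : ∀ n ∈ p.support, n 0 + n 1 + n 2 = t) (h₀ : ∀ n ∈ p.support, n 0 % 2 = ε₀)
    (h₁ : ∀ n ∈ p.support, n 1 % 2 = ε₁) (h₂ : ∀ n ∈ p.support, n 2 % 2 = ε₂) (hr : 1 ≤ r)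
    (hm : 2 * r ≤ m + 2) (hmr : 2 * r ≤ m + 1 ∨ 3 ≤ r) (hl : 2 * (l + 3 * r) ≤ 5 * m + 1) :
    p ∈ idealOfVars (Fin 3) K ^ l * fermatIdeal K 2 ^ r := by
  let half (n : Fin 3 →₀ ℕ) : Fin 3 →₀ ℕ := n.mapRange (fun j => j / 2) (by simp)
  have hhalf (n : Fin 3 →₀ ℕ) (i : Fin 3) : half n i = n i / 2 := Finsupp.mapRange_apply ..
  set q : MvPolynomial (Fin 3) K := ∑ n ∈ p.support, monomial (half n) (coeff n p) with hq
  have hpq : p = X 0 ^ ε₀ * X 1 ^ ε₁ * X 2 ^ ε₂ * expand 2 q := by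
    rw [hq, map_sum, Finset.mul_sum]
    conv_lhs => rw [p.as_sum]
    refine Finset.sum_congr rfl fun n hn => ?_
    have hmon (d : Fin 3 →₀ ℕ) (a : K) :
        monomial d a = C a * (X 0 ^ d 0 * X 1 ^ d 1 * X 2 ^ d 2) := by
      rw [monomial_eq, Finsupp.prod_fintype _ _ (by simp), Fin.prod_univ_three]
    rw [hmon, hmon, map_mul, map_mul, map_mul, map_pow, map_pow, map_pow, expand_X, expand_X,
      expand_X, expand_C, hhalf, hhalf, hhalf, ← pow_mul, ← pow_mul, ← pow_mul]
    conv_lhs => rw [← Nat.mod_add_div (n 0) 2, ← Nat.mod_add_div (n 1) 2,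
      ← Nat.mod_add_div (n 2) 2, h₀ n hn, h₁ n hn, h₂ n hn]
    ring
  have hqt : q.IsHomogeneous ((t - ε₀ - ε₁ - ε₂) / 2) := by
    refine IsHomogeneous.sum _ _ _ fun n hn => isHomogeneous_monomial _ ?_
    rw [Finsupp.degree_eq_sum, Fin.sum_univ_three, hhalf, hhalf, hhalf]
    have := ht n hn
    have := h₀ n hn
    have := h₁ n hn
    have := h₂ n hn
    omega
  have hqw (k : Fin 3) (m' : ℕ) (hm' : ∀ n ∈ p.support, m ≤ ∑ i, n i * coordWeight k i →
      m' ≤ ∑ i, half n i * coordWeight k i) :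
      Polynomial.X ^ m' ∣ weightHom K (coordWeight k) q := by
    rw [hq, map_sum]
    refine Finset.dvd_sum fun n hn => ?_
    rw [weightHom_monomial]
    exact Dvd.dvd.mul_left
      (pow_dvd_pow _ (hm' n hn ((pow_dvd_weightHom_iff _).mp (hw k) n hn))) _
  -- Halving exponents halves the coordinate orders; the +1 rounds up, so that restoring the
  -- monomial gives back order `m`.
  have hord : HasOrders m ((m + 1 - ε₁ - ε₂) / 2) ((m + 1 - ε₀ - ε₂) / 2) ((m + 1 - ε₀ - ε₁) / 2)
      q := by
    refine ⟨?_, hqw 0 _ ?_, hqw 1 _ ?_, hqw 2 _ ?_⟩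
    · rw [hpq, map_mul] at hp
      -- The monomial factor does not vanish at (1,1,1), so the whole order belongs to q(x², y²,
      -- z²).
      refine Polynomial.prime_X.pow_dvd_of_dvd_mul_left m (not_X_dvd_of_coeff ?_) hp
      rw [pointHom, coeff_zero_aeval]
      simp
    all_goals
      intro n hn
      have := h₀ n hn
      have := h₁ n hn
      have := h₂ n hn
      simp only [Fin.sum_univ_three, hhalf, coordWeight]
      simp
      omega
  have hspan := mem_span_diffProducts _ hqt hord
  rw [hpq]
  clear_value q
  clear hq hpq hqt hqw hord
  induction hspan using Submodule.span_induction with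
  | mem g hg =>
    obtain ⟨a, b, c, d, e, f, -, k0, k1, k2, k3, rfl⟩ := hg
    have : X 0 ^ ε₀ * X 1 ^ ε₁ * X 2 ^ ε₂ * expand 2 (diffProduct K a b c d e f) =
        lineProduct (X 0) (X 1) (X 2) (ε₀ + 2 * a) (ε₁ + 2 * b) (ε₂ + 2 * c) d e f := by
      simp only [diffProduct, lineProduct, map_mul, map_pow, map_sub, expand_X, pow_add, pow_mul]
      ring
    rw [this]
    exact lineProduct_mem_pow_mul_pow (m := m) (by omega) (by omega) (by omega) k0 hr hm hmr hl
  | zero => simp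
  | add x y _ _ hx hy => rw [map_add, mul_add]; exact add_mem hx hy
  | smul a x _ hx =>
    rw [map_smul, mul_smul_comm, smul_eq_C_mul]; exact Ideal.mul_mem_left _ _ hx

theorem symbolicPower_fermatIdeal_two_le [CharZero K] {m l r : ℕ} (hr : 1 ≤ r)
    (hm : 2 * r ≤ m + 2) (hmr : 2 * r ≤ m + 1 ∨ 3 ≤ r) (hl : 2 * (l + 3 * r) ≤ 5 * m + 1) :
    (fermatIdeal K 2).symbolicPower m ≤ idealOfVars (Fin 3) K ^ l * fermatIdeal K 2 ^ r := by
  intro p hp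
  have hw (k : Fin 3) := (pow_dvd_weightHom_iff _).mp (pow_dvd_weightHom_of_mem_symbolicPower k hp)
  have hV : p ∈ ordersSubmodule K m :=
    fun c hc hcc => pow_dvd_pointHom_of_mem_symbolicPower hc hcc hp
  refine mem_of_forall_degree_component_mem hV fun p₁ hp₁ hs₁ ⟨t, ht⟩ => ?_
  refine mem_of_forall_parity_component_mem 0 hp₁ fun p₂ hp₂ hs₂ ⟨ε₀, h₀⟩ => ?_
  refine mem_of_forall_parity_component_mem 1 hp₂ fun p₃ hp₃ hs₃ ⟨ε₁, h₁⟩ => ?_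
  refine mem_of_forall_parity_component_mem 2 hp₃ fun p₄ hp₄ hs₄ ⟨ε₂, h₂⟩ => ?_
  exact mem_of_homogeneous_of_parity (hp₄ 1 (by simp) (by simp))
    (fun k => (pow_dvd_weightHom_iff _).mpr fun n hn => hw k n (hs₁ (hs₂ (hs₃ (hs₄ hn)))))
    (fun n hn => ht n (hs₂ (hs₃ (hs₄ hn)))) (fun n hn => h₀ n (hs₃ (hs₄ hn)))
    (fun n hn => h₁ n (hs₄ hn)) h₂ hr hm hmr hl

end Containment

theorem mainTheorem10 (K : Type*) [Field K] [IsAlgClosed K] [CharZero K] :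
    (∀ r : ℕ, 5 ≤ r →
      (fermatIdeal K 2).symbolicPower (2 * r - 2) ≤
        MvPolynomial.idealOfVars (Fin 3) K ^ r * fermatIdeal K 2 ^ r) ∧
    (∀ r : ℕ,
      (fermatIdeal K 2).symbolicPower (2 * r) ≤
        MvPolynomial.idealOfVars (Fin 3) K ^ r * fermatIdeal K 2 ^ r) ∧
    (∀ r : ℕ, 1 ≤ r →
      (fermatIdeal K 2).symbolicPower (2 * r - 1) ≤
        MvPolynomial.idealOfVars (Fin 3) K ^ (r - 1) * fermatIdeal K 2 ^ r) := by
  refine ⟨fun r hr => ?_, fun r => ?_, fun r hr => ?_⟩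
  -- The degree bound reads 8r ≤ 10r - 9, which is exactly r ≥ 5; membership in I^r alone would need
  -- only r ≥ 3.
  · exact symbolicPower_fermatIdeal_two_le (by omega) (by omega) (by omega) (by omega)
  · rcases Nat.eq_zero_or_pos r with rfl | hr
    · simp
    · exact symbolicPower_fermatIdeal_two_le (by omega) (by omega) (by omega) (by omega)
  · exact symbolicPower_fermatIdeal_two_le (by omega) (by omega) (by omega) (by omega)
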